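/- Consider the problem $\min_{x,z} F(x)+\phi(z)$ subject to $A(x)+Qz=0$, where $x=(x_1,\dots,x_n)$ has blocks $x_i\in\mathbb{R}^{n_i}$, $n_x=n_1+\dots+n_n$, $z\in\mathbb{R}^{n_z}$, $Q\in\mathbb{R}^{n_c\times n_z}$, and assume: (a) $A:\mathbb{R}^{n_x}\to\mathbb{R}^{n_c}$ is a multi-affine quadratic operator: for each $l$ there are $C_l\in\mathbb{R}^{n_x\times n_x}$, $d_l\in\mathbb{R}^{n_x}$, $e_l\in\mathbb{R}$ with $A(x)_l=\tfrac12 x^TC_lx+d_l^Tx+e_l$ for all $x$, and for every $j$ the map $x_j\mapsto A(x_j;x_{-j})$ is affine for every fixed $x_{-j}$; (b) $F(x)=f(x)+\sum_{i=1}^n I_i(x_i)$ is subanalytic, where $f$ is $C^2$ and $\mu_f$-strongly convex with $\mu_f>0$, and $I_i$ is the $\{0,+\infty\}$-valued indicator function of a closed convex set $X_i\subseteq\mathbb{R}^{n_i}$; (c) $\phi$ is $C^2$, $\mu_\phi$-strongly convex with $\mu_\phi>0$, and $L_\phi$-smooth ($\nabla\phi$ is $L_\phi$-Lipschitz, $L_\phi>0$);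 (d) $Q$ has full row rank. Let $\rho>0$ satisfy $$\rho\ \ge\ \max\Big\{\frac{4L_\phi^2}{\mu_\phi\,\lambda_{\min}^+(Q^TQ)},\ \frac{4L_\phi^2}{\mu_\phi\sqrt{\lambda_{\min}^+(QQ^T)}}\Big\},$$ where $\lambda_{\min}^+$ denotes the smallest positive eigenvalue (this condition is void when $n_c=0$), and let $$L(x,z,w)=F(x)+\phi(z)+\langle w,A(x)+Qz\rangle+\tfrac{\rho}{2}\|A(x)+Qz\|^2 .$$ Let $(x^k,z^k,w^k)_{k\ge0}$ be a sequence generated by ADMM, i.e. for all $k\ge 0$: $x_i^{k+1}\in\arg\min_{x_i}L(x_1^{k+1},\dots,x_{i-1}^{k+1},x_i,x_{i+1}^k,\dots,x_n^k,z^k,w^k)$ for $i=1,\dots,n$ in this order, $z^{k+1}\in\arg\min_z L(x^{k+1},z,w^k)$, and $w^{k+1}=w^k+\rho(A(x^{k+1})+Qz^{k+1})$, where the $\arg\min$ of a function that is identically $+\infty$ is empty. If $(x^k,z^k,w^k)$ converges to a point $(x^\star,z^\star,w^\star)$ with $w^\star=0$, then $L(x^\star,z^\star,w^\star)$ and all $L(x^k,z^k,w^k)$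 with $k\ge1$ are finite, and there is $c_1>1$ such that $$L(x^k,z^k,w^k)-L(x^\star,z^\star,w^\star)\in\mathcal{O}(c_1^{-k})\quad\text{as }k\to\infty .$$ -/

import Mathlib

open Filter Topology Asymptotics
open scoped Matrix RealInnerProductSpace

namespace ADMM

/-- Semianalytic subset of a real normed space: near every point it is a finite union of sets cut
out by one analytic equation and finitely many strict analytic inequalities. -/
def IsSemianalytic {E : Type*} [NormedAddCommGroup E] [NormedSpace ℝ E] (S : Set E) : Prop :=
  ∀ a : E, ∃ U : Set E, IsOpen U ∧ a ∈ U ∧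
    ∃ (p q : ℕ) (f : Fin p → E → ℝ) (g : Fin p → Fin q → E → ℝ),
      (∀ i, AnalyticOnNhd ℝ (f i) U) ∧ (∀ i j, AnalyticOnNhd ℝ (g i j) U) ∧
      S ∩ U = {x | x ∈ U ∧ ∃ i, f i x = 0 ∧ ∀ j, 0 < g i j x}

/-- Subanalytic subset of a finite-dimensional real space: near every point it is the projection
of a relatively compact semianalytic subset of a product with some `ℝ ^ m`. -/
def IsSubanalytic {E : Type*} [NormedAddCommGroup E] [NormedSpace ℝ E] (V : Set E) : Prop :=
  ∀ a : E, ∃ U : Set E, IsOpen U ∧ a ∈ U ∧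
    ∃ (m : ℕ) (S : Set (E × EuclideanSpace ℝ (Fin m))),
      IsSemianalytic S ∧ Bornology.IsBounded S ∧ V ∩ U = (Prod.fst '' S) ∩ U

/-- An extended-real-valued function is subanalytic if its graph (over its finite values) is. -/
def IsSubanalyticFun {E : Type*} [NormedAddCommGroup E] [NormedSpace ℝ E] (F : E → EReal) : Prop :=
  IsSubanalytic {p : E × ℝ | (p.2 : EReal) = F p.1}

/-- Vectors `x = (x₁, …, xₙ)` with blocks `xᵢ ∈ ℝ ^ (d i)`, with the Euclidean norm. -/
abbrev BlockVec {n : ℕ} (d : Fin n → ℕ) : Type :=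
  PiLp 2 (fun i : Fin n => EuclideanSpace ℝ (Fin (d i)))

/-- The coordinates of a block vector, listed over all pairs (block, position in the block). -/
def coords {n : ℕ} {d : Fin n → ℕ} (x : BlockVec d) : (Σ i : Fin n, Fin (d i)) → ℝ :=
  fun p => x p.1 p.2

/-- The vector `x` with its `j`-th block replaced by `y`. -/
def setBlock {n : ℕ} {d : Fin n → ℕ} (x : BlockVec d) (j : Fin n)
    (y : EuclideanSpace ℝ (Fin (d j))) : BlockVec d :=
  WithLp.toLp 2 (Function.update x.ofLp j y)

/-- Multi-affine quadratic operators: every component is `xᵀ C x / 2 + bᵀ x + e`, and the operator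
is affine in each block when the other blocks are fixed. -/
structure IsMultiAffineQuadratic {n nc : ℕ} {d : Fin n → ℕ}
    (A : BlockVec d → EuclideanSpace ℝ (Fin nc)) : Prop where
  quadratic : ∀ l : Fin nc, ∃ (C : Matrix (Σ i : Fin n, Fin (d i)) (Σ i : Fin n, Fin (d i)) ℝ)
    (b : (Σ i : Fin n, Fin (d i)) → ℝ) (e : ℝ), ∀ x : BlockVec d,
      A x l = (coords x ⬝ᵥ (C *ᵥ coords x)) / 2 + b ⬝ᵥ coords x + e
  affine : ∀ (j : Fin n) (x : BlockVec d),
    ∃ g : EuclideanSpace ℝ (Fin (d j)) →ᵃ[ℝ] EuclideanSpace ℝ (Fin nc),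
      ∀ y, A (setBlock x j y) = g y

/-- `g` has a Lipschitz gradient with constant `L > 0`. -/
def IsLSmooth {E : Type*} [NormedAddCommGroup E] [InnerProductSpace ℝ E] [CompleteSpace E]
    (L : ℝ) (g : E → ℝ) : Prop :=
  0 < L ∧ ∀ x x' : E, ‖gradient g x - gradient g x'‖ ≤ L * ‖x - x'‖

open Classical in
/-- Convex-analytic indicator: `0` on the set and `+∞` off it. -/
noncomputable def convexIndicator {E : Type*} (X : Set E) (x : E) : EReal :=
  if x ∈ X then 0 else ⊤

/-- `F(x) = f(x) + ∑ᵢ Iᵢ(xᵢ)`. -/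
noncomputable def objective {n : ℕ} {d : Fin n → ℕ} (f : BlockVec d → ℝ)
    (X : ∀ i : Fin n, Set (EuclideanSpace ℝ (Fin (d i)))) (x : BlockVec d) : EReal :=
  (f x : EReal) + ∑ i, convexIndicator (X i) (x i)

/-- The constraint map `A(x) + Q z`. -/
noncomputable def residual {n nc nz : ℕ} {d : Fin n → ℕ}
    (A : BlockVec d → EuclideanSpace ℝ (Fin nc)) (Q : Matrix (Fin nc) (Fin nz) ℝ)
    (x : BlockVec d) (z : EuclideanSpace ℝ (Fin nz)) : EuclideanSpace ℝ (Fin nc) :=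
  A x + WithLp.toLp 2 (Q *ᵥ z.ofLp)

/-- The augmented Lagrangian `F(x) + φ(z) + ⟨w, A(x) + Q z⟩ + (ρ / 2) ‖A(x) + Q z‖²`. -/
noncomputable def augLagrangian {n nc nz : ℕ} {d : Fin n → ℕ} (f : BlockVec d → ℝ)
    (X : ∀ i : Fin n, Set (EuclideanSpace ℝ (Fin (d i)))) (φ : EuclideanSpace ℝ (Fin nz) → ℝ)
    (A : BlockVec d → EuclideanSpace ℝ (Fin nc)) (Q : Matrix (Fin nc) (Fin nz) ℝ) (ρ : ℝ)
    (x : BlockVec d) (z : EuclideanSpace ℝ (Fin nz)) (w : EuclideanSpace ℝ (Fin nc)) : EReal :=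
  objective f X x +
    ((φ z + ⟪w, residual A Q x z⟫ + ρ / 2 * ‖residual A Q x z‖ ^ 2 : ℝ) : EReal)

/-- The set of minimizers of an extended-real-valued function; as usual it is empty when the
function is identically `+∞`. -/
def argminSet {E : Type*} (g : E → EReal) : Set E :=
  {y | g y ≠ ⊤ ∧ ∀ y', g y ≤ g y'}

/-- `(u₁, …, uᵢ₋₁, y, vᵢ₊₁, …, vₙ)`. -/
def gaussSeidelPoint {n : ℕ} {d : Fin n → ℕ} (u v : BlockVec d) (i : Fin n)
    (y : EuclideanSpace ℝ (Fin (d i))) : BlockVec d :=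
  setBlock (WithLp.toLp 2 (fun j => if j < i then u j else v j)) i y

/-- The sequences `x`, `z`, `w` are produced by ADMM for the augmented Lagrangian. -/
structure IsADMM {n nc nz : ℕ} {d : Fin n → ℕ} (f : BlockVec d → ℝ)
    (X : ∀ i : Fin n, Set (EuclideanSpace ℝ (Fin (d i)))) (φ : EuclideanSpace ℝ (Fin nz) → ℝ)
    (A : BlockVec d → EuclideanSpace ℝ (Fin nc)) (Q : Matrix (Fin nc) (Fin nz) ℝ) (ρ : ℝ)
    (x : ℕ → BlockVec d) (z : ℕ → EuclideanSpace ℝ (Fin nz))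
    (w : ℕ → EuclideanSpace ℝ (Fin nc)) : Prop where
  x_step : ∀ (k : ℕ) (i : Fin n), x (k + 1) i ∈ argminSet (fun y =>
    augLagrangian f X φ A Q ρ (gaussSeidelPoint (x (k + 1)) (x k) i y) (z k) (w k))
  z_step : ∀ k : ℕ, z (k + 1) ∈ argminSet (fun y =>
    augLagrangian f X φ A Q ρ (x (k + 1)) y (w k))
  w_step : ∀ k : ℕ, w (k + 1) = w k + ρ • residual A Q (x (k + 1)) (z (k + 1))

/-- The smallest positive eigenvalue of a square matrix (`0` if there is none). -/
noncomputable def minPosEigenvalue {m : ℕ} (B : Matrix (Fin m) (Fin m) ℝ) : ℝ :=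
  sInf {t : ℝ | 0 < t ∧ Module.End.HasEigenvalue (Matrix.toLin' B) t}

end ADMM

/-! The augmented Lagrangian is not jointly convex in `(x, z)`, because `A` is quadratic. In its
second derivative, however, the only possibly negative part is that of `A` paired with `w + ρ (A x +
Q z)`. This effective multiplier tends to `0`: the limit is feasible since the multiplier steps
vanish, and the limit multiplier is zero. Near the limit the strong convexity of `f` absorbs that
part, so the smooth part `H` of the Lagrangian obeys a strongly convex first-order inequality
towards `(xs, zs)` (`eventually_smoothLagrangian_le`).

The iterates are stationary up to the size of the last step, so this inequality bounds the gap `a (k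
+ 1)` in `H` by a constant times the squared step (`error_bound`). Conversely, an iteration lowers
`H` by a multiple of the squared primal step (`IsADMM.descent`). Only the multiplier update raises
`H`; the identity `Qᵀ w = -∇φ(z)`, the full row rank of `Q` and the size of `ρ` keep that rise below
half of the decrease gained in `z` (`IsADMM.norm_sq_multiplier_step_le`). Hence `a (k + 1) ≤ C (a k
- a (k + 1))`, which is geometric decay. -/

namespace ADMM

/-! ### Strong convexity and first-order conditions -/

section ConvexAnalysis

variable {E : Type*} [NormedAddCommGroup E] [NormedSpace ℝ E]

theorem le_of_forall_one_sub_mul_le {a b : ℝ}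
    (h : ∀ t : ℝ, 0 < t → t < 1 → (1 - t) * a ≤ b) : a ≤ b := by
  have h1 : Tendsto (fun t : ℝ => (1 - t) * a) (𝓝[>] 0) (𝓝 ((1 - 0) * a)) :=
    (Continuous.tendsto (by fun_prop) 0).mono_left nhdsWithin_le_nhds
  have h2 : ∀ᶠ t : ℝ in 𝓝[>] 0, (1 - t) * a ≤ b := by
    filter_upwards [Ioo_mem_nhdsGT (zero_lt_one (α := ℝ))] with t ht using h t ht.1 ht.2
  simpa using le_of_tendsto h1 h2

/-- Quadratic growth of a strongly convex function away from a minimizer. -/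
theorem quadratic_growth_of_isMinOn {s : Set E} {m : ℝ} {g : E → ℝ}
    (hg : StrongConvexOn s m g) {x y : E} (hx : x ∈ s) (hy : y ∈ s)
    (hmin : ∀ y ∈ s, g x ≤ g y) : g x + m / 2 * ‖y - x‖ ^ 2 ≤ g y := by
  have key : m / 2 * ‖y - x‖ ^ 2 ≤ g y - g x := by
    refine le_of_forall_one_sub_mul_le fun t ht0 ht1 => ?_
    have h1 := hg.2 hx hy (sub_nonneg.2 ht1.le) ht0.le (by ring)
    have h2 := hmin _ (hg.1 hx hy (sub_nonneg.2 ht1.le) ht0.le (by ring))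
    rw [norm_sub_rev] at h1
    simp only [smul_eq_mul] at h1
    have h3 : t * ((1 - t) * (m / 2 * ‖y - x‖ ^ 2)) ≤ t * (g y - g x) := by nlinarith
    exact le_of_mul_le_mul_left h3 ht0
  linarith

/-- The derivative is nonnegative in the direction of a segment on which the base point is
minimal. -/
theorem fderiv_sub_nonneg_of_min_segment {g : E → ℝ} {x y : E} (hg : DifferentiableAt ℝ g x)
    (hmin : ∀ q ∈ segment ℝ x y, g x ≤ g q) : 0 ≤ fderiv ℝ g x (y - x) :=
  IsLocalMinOn.hasFDerivWithinAt_nonneg (s := segment ℝ x y)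
    (IsMinOn.localize hmin) hg.hasFDerivAt.hasFDerivWithinAt
    (sub_mem_posTangentConeAt_of_segment_subset subset_rfl)

/-- First-order lower bound for strongly convex functions. -/
theorem add_fderiv_le_of_strongConvexOn {m : ℝ} {g : E → ℝ} (hg : StrongConvexOn Set.univ m g)
    {x : E} (hd : DifferentiableAt ℝ g x) (y : E) :
    g x + fderiv ℝ g x (y - x) + m / 2 * ‖y - x‖ ^ 2 ≤ g y := by
  have key : fderiv ℝ g x (y - x) ≤ g y - g x - m / 2 * ‖y - x‖ ^ 2 := by
    -- The added term is the strong convexity defect, proportional to `t (1 - t)`. With it, all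
    -- right difference quotients at `0` are at most `g y - g x`, and it contributes its full
    -- coefficient to the derivative.
    have h0 : HasDerivAt (fun t : ℝ => g (x + t • (y - x)) + m / 2 * ‖y - x‖ ^ 2 * (t - t ^ 2))
        (fderiv ℝ g x (y - x) + m / 2 * ‖y - x‖ ^ 2) 0 := by
      have h1 : HasDerivAt (fun t : ℝ => x + t • (y - x)) (y - x) 0 := by
        simpa using ((hasDerivAt_id (0 : ℝ)).smul_const (y - x)).const_add x
      have h2 := HasFDerivAt.comp_hasDerivAt (0 : ℝ) (l := g) (l' := fderiv ℝ g x)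
        (by simpa using hd.hasFDerivAt) h1
      have h3 : HasDerivAt (fun t : ℝ => t - t ^ 2) 1 0 := by
        exact ((hasDerivAt_id (0 : ℝ)).sub ((hasDerivAt_id (0 : ℝ)).pow 2)).congr_deriv (by simp)
      exact (h2.add (h3.const_mul (m / 2 * ‖y - x‖ ^ 2))).congr_deriv (by simp)
    have h4 := h0.tendsto_slope_zero_right
    have h5 : ∀ᶠ t : ℝ in 𝓝[>] 0,
        t⁻¹ • ((g (x + (0 + t) • (y - x)) + m / 2 * ‖y - x‖ ^ 2 * ((0 + t) - (0 + t) ^ 2)) -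
          (g (x + (0 : ℝ) • (y - x)) + m / 2 * ‖y - x‖ ^ 2 * (0 - 0 ^ 2))) ≤ g y - g x := by
      filter_upwards [Ioo_mem_nhdsGT (zero_lt_one (α := ℝ))] with t ht
      have h1 := hg.2 (Set.mem_univ x) (Set.mem_univ y) (sub_nonneg.2 ht.2.le) ht.1.le (by ring)
      have h2 : (1 - t) • x + t • y = x + t • (y - x) := by module
      rw [h2, norm_sub_rev] at h1
      simp only [smul_eq_mul] at h1
      rw [smul_eq_mul, inv_mul_le_iff₀ ht.1]
      simp only [zero_add, zero_smul, add_zero]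
      nlinarith
    have := le_of_tendsto h4 h5
    linarith
  linarith

theorem strongConvexOn_add_convexOn {s : Set E} {m : ℝ} {g h : E → ℝ} (hg : StrongConvexOn s m g)
    (hh : ConvexOn ℝ s h) : StrongConvexOn s m (fun x => g x + h x) := by
  have := UniformConvexOn.add hg (uniformConvexOn_zero.2 hh)
  rwa [add_zero] at this

/-- Makes the multiplier and penalty terms convex in any variable on which the residual depends
affinely: a single block of `x`, or `z`. -/
theorem convexOn_inner_add_sq {G : Type*} [NormedAddCommGroup G] [InnerProductSpace ℝ G] {ρ : ℝ}
    (hρ : 0 ≤ ρ) (w : G) (T : E →ᵃ[ℝ] G) :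
    ConvexOn ℝ Set.univ (fun y => ⟪w, T y⟫ + ρ / 2 * ‖T y‖ ^ 2) := by
  have h1 : ConvexOn ℝ Set.univ (fun r : G => ⟪w, r⟫ + ρ / 2 * ‖r‖ ^ 2) := by
    refine ((innerSL ℝ w).toLinearMap.convexOn convex_univ).add ?_
    exact ((convexOn_univ_norm (E := G)).pow (fun _ _ => norm_nonneg _) 2).smul (by positivity)
  exact h1.comp_affineMap T

end ConvexAnalysis

/-! ### The smallest positive eigenvalue and the lower bound for `Qᵀ` -/

section Spectral

variable {nc nz : ℕ}

/-- The continuous linear map of a matrix between Euclidean spaces. -/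
noncomputable def matCLM (Q : Matrix (Fin nc) (Fin nz) ℝ) :
    EuclideanSpace ℝ (Fin nz) →L[ℝ] EuclideanSpace ℝ (Fin nc) :=
  LinearMap.toContinuousLinearMap (Matrix.toEuclideanLin Q)

theorem matCLM_apply (Q : Matrix (Fin nc) (Fin nz) ℝ) (v : EuclideanSpace ℝ (Fin nz)) :
    matCLM Q v = WithLp.toLp 2 (Q *ᵥ v.ofLp) := rfl

theorem inner_matCLM_transpose (Q : Matrix (Fin nc) (Fin nz) ℝ) (v : EuclideanSpace ℝ (Fin nc))
    (u : EuclideanSpace ℝ (Fin nz)) : ⟪matCLM Qᵀ v, u⟫ = ⟪v, matCLM Q u⟫ := by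
  simp only [matCLM_apply, EuclideanSpace.inner_eq_star_dotProduct, star_trivial]
  rw [Matrix.mulVec_transpose, dotProduct_comm, ← Matrix.dotProduct_mulVec, dotProduct_comm]

theorem matCLM_transpose_injective {Q : Matrix (Fin nc) (Fin nz) ℝ} (hQ : Q.rank = nc) :
    Function.Injective (matCLM Qᵀ) := by
  have h : LinearIndependent ℝ Q.row := by
    rw [linearIndependent_iff_card_eq_finrank_span, Set.finrank, ← Matrix.rank_eq_finrank_span_row, hQ,
      Fintype.card_fin]
  intro u v huv
  have h2 : Function.Injective (fun v => v ᵥ* Q) := Matrix.vecMul_injective_iff.2 h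
  apply WithLp.ofLp_injective
  apply h2
  simpa [matCLM_apply, Matrix.mulVec_transpose] using huv

/-- The infimum `l` of the Rayleigh quotient of `Q Qᵀ` is an eigenvalue, positive because `Qᵀ` is
injective. If `u` is an eigenvector for it, then `Qᵀ u` is one of `Qᵀ Q` for the same `l`, so the
smallest positive eigenvalue of `Qᵀ Q` is at most `l`. -/
theorem minPosEigenvalue_pos_and_mul_norm_sq_le {Q : Matrix (Fin nc) (Fin nz) ℝ} (hQ : Q.rank = nc)
    (v : EuclideanSpace ℝ (Fin nc)) (hv : v ≠ 0) :
    0 < minPosEigenvalue (Qᵀ * Q) ∧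
      minPosEigenvalue (Qᵀ * Q) * ‖v‖ ^ 2 ≤ ‖matCLM Qᵀ v‖ ^ 2 := by
  set T : EuclideanSpace ℝ (Fin nc) →ₗ[ℝ] EuclideanSpace ℝ (Fin nc) :=
    (matCLM Q).toLinearMap ∘ₗ (matCLM Qᵀ).toLinearMap with hT
  have hTi : ∀ u v, ⟪T u, v⟫ = ⟪matCLM Qᵀ u, matCLM Qᵀ v⟫ := by
    intro u v
    rw [real_inner_comm, ← inner_matCLM_transpose, real_inner_comm]
    rfl
  have hsymm : T.IsSymmetric := by
    intro u v
    rw [hTi, real_inner_comm, ← hTi, real_inner_comm]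
  have : Nontrivial (EuclideanSpace ℝ (Fin nc)) := ⟨v, 0, hv⟩
  have heig := hsymm.hasEigenvalue_iInf_of_finiteDimensional
  set l : ℝ := ⨅ x : {x : EuclideanSpace ℝ (Fin nc) // x ≠ 0},
    RCLike.re ⟪T x, x⟫ / ‖(x : EuclideanSpace ℝ (Fin nc))‖ ^ 2 with hl
  have hle : l * ‖v‖ ^ 2 ≤ ‖matCLM Qᵀ v‖ ^ 2 := by
    have hb : BddBelow (Set.range fun x : {x : EuclideanSpace ℝ (Fin nc) // x ≠ 0} =>
        RCLike.re ⟪T x, x⟫ / ‖(x : EuclideanSpace ℝ (Fin nc))‖ ^ 2) := by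
      refine ⟨0, ?_⟩
      rintro _ ⟨y, rfl⟩
      simp only [hTi, real_inner_self_eq_norm_sq, RCLike.re_to_real]
      positivity
    have h1 := ciInf_le hb ⟨v, hv⟩
    have hv' : 0 < ‖v‖ ^ 2 := by positivity
    simp only [hTi, real_inner_self_eq_norm_sq, RCLike.re_to_real] at h1
    rw [le_div_iff₀ hv'] at h1
    simpa [hl, hTi] using h1
  obtain ⟨u, hu⟩ := heig.exists_hasEigenvector
  have hTu : T u = l • u := hu.apply_eq_smul
  have hu0 : u ≠ 0 := hu.2
  have hQu : matCLM Qᵀ u ≠ 0 := fun h => hu0 (matCLM_transpose_injective hQ (by simpa using h))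
  have hlu : l * ‖u‖ ^ 2 = ‖matCLM Qᵀ u‖ ^ 2 := by
    rw [← real_inner_self_eq_norm_sq (matCLM Qᵀ u), ← hTi, hTu, real_inner_smul_left,
      real_inner_self_eq_norm_sq]
  have hl0 : 0 < l := by
    have h1 : 0 < l * ‖u‖ ^ 2 := by rw [hlu]; positivity
    exact pos_of_mul_pos_left h1 (by positivity)
  have hmem : l ∈ {t : ℝ | 0 < t ∧ Module.End.HasEigenvalue (Matrix.toLin' (Qᵀ * Q)) t} := by
    refine ⟨hl0, Module.End.hasEigenvalue_of_hasEigenvector (x := (matCLM Qᵀ u).ofLp) ⟨?_, ?_⟩⟩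
    · rw [Module.End.mem_eigenspace_iff, Matrix.toLin'_apply, ← Matrix.mulVec_mulVec]
      have h1 : matCLM Qᵀ (T u) = l • matCLM Qᵀ u := by rw [hTu, map_smul]
      exact congrArg WithLp.ofLp h1
    · intro h
      exact hQu (WithLp.ofLp_injective 2 h)
  have hfin : {t : ℝ | 0 < t ∧ Module.End.HasEigenvalue (Matrix.toLin' (Qᵀ * Q)) t}.Finite :=
    (Module.End.finite_hasEigenvalue _).subset fun t ht => ht.2
  refine ⟨(Set.Nonempty.csInf_mem ⟨l, hmem⟩ hfin).1, le_trans ?_ hle⟩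
  exact mul_le_mul_of_nonneg_right (csInf_le hfin.bddBelow hmem) (by positivity)

theorem norm_sq_le_of_penalty_le {Q : Matrix (Fin nc) (Fin nz) ℝ} (hQ : Q.rank = nc)
    {L μ ρ : ℝ} (hμ : 0 < μ) (hρ : 4 * L ^ 2 / (μ * minPosEigenvalue (Qᵀ * Q)) ≤ ρ)
    (v : EuclideanSpace ℝ (Fin nc)) : 4 * L ^ 2 * ‖v‖ ^ 2 ≤ ρ * μ * ‖matCLM Qᵀ v‖ ^ 2 := by
  rcases eq_or_ne v 0 with rfl | hv
  -- This case covers `nc = 0`, where there is no positive eigenvalue and `minPosEigenvalue` takes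
  -- its default value `0`.
  · simp
  obtain ⟨h0, h1⟩ := minPosEigenvalue_pos_and_mul_norm_sq_le hQ v hv
  have hρ0 : 0 ≤ ρ := le_trans (by positivity) hρ
  rw [div_le_iff₀ (by positivity)] at hρ
  calc 4 * L ^ 2 * ‖v‖ ^ 2 ≤ ρ * (μ * minPosEigenvalue (Qᵀ * Q)) * ‖v‖ ^ 2 := by gcongr
    _ = ρ * μ * (minPosEigenvalue (Qᵀ * Q) * ‖v‖ ^ 2) := by ring
    _ ≤ _ := by gcongr

end Spectral
-- The smooth Lagrangian and its convexity-like behaviour near the limit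
section SmoothLagrangian

variable {E Z G : Type*} [NormedAddCommGroup E] [NormedSpace ℝ E]
  [NormedAddCommGroup Z] [NormedSpace ℝ Z] [NormedAddCommGroup G] [InnerProductSpace ℝ G]

/-- The derivative of `A` is `C¹`, hence Lipschitz near `xs`; the mean value inequality on the
segment gives the bound. The expansion is based at the moving point `x`, with one `K` for all of
them. -/
theorem eventually_taylor_remainder_le {A : E → G} (hA : ContDiff ℝ 2 A) (xs : E) :
    ∃ K : ℝ, 0 ≤ K ∧ ∀ᶠ x in 𝓝 xs, ‖A xs - A x - fderiv ℝ A x (xs - x)‖ ≤ K * ‖xs - x‖ ^ 2 := by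
  have h1 : ContDiff ℝ 1 (fderiv ℝ A) := hA.fderiv_right (by norm_num)
  obtain ⟨K, t, ht, hK⟩ := h1.contDiffAt.exists_lipschitzOnWith (x := xs)
  obtain ⟨r, hr, hrt⟩ := Metric.mem_nhds_iff.1 ht
  refine ⟨K, K.2, ?_⟩
  filter_upwards [Metric.ball_mem_nhds xs hr] with x hx
  have hseg : segment ℝ x xs ⊆ t :=
    ((convex_ball xs r).segment_subset hx (Metric.mem_ball_self hr)).trans hrt
  have := Convex.norm_image_sub_le_of_norm_fderiv_le' (f := A) (C := K * ‖xs - x‖)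
    (s := segment ℝ x xs) (x := x) (y := xs) (φ := fderiv ℝ A x) (𝕜 := ℝ)
    (fun y _ => (hA.differentiable (by norm_num)) y) (fun y hy => ?_) (convex_segment _ _)
    (left_mem_segment ..) (right_mem_segment ..)
  · calc _ ≤ _ := this
      _ = _ := by ring
  · calc _ ≤ K * ‖y - x‖ := hK.norm_sub_le (hseg hy) (hseg (left_mem_segment ..))
      _ ≤ _ := by gcongr; exact norm_sub_le_of_mem_segment hy

/-- The real-valued part of the augmented Lagrangian, as a function of `(x, z, w)`. -/
noncomputable def smoothLagrangian (f : E → ℝ) (φ : Z → ℝ) (A : E → G) (Q : Z →L[ℝ] G) (ρ : ℝ)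
    (p : E × Z × G) : ℝ :=
  f p.1 + φ p.2.1 + ⟪p.2.2, A p.1 + Q p.2.1⟫ + ρ / 2 * ‖A p.1 + Q p.2.1‖ ^ 2

variable {f : E → ℝ} {φ : Z → ℝ} {A : E → G} {Q : Z →L[ℝ] G} {ρ : ℝ}

theorem contDiff_smoothLagrangian (hf : ContDiff ℝ 2 f) (hφ : ContDiff ℝ 2 φ)
    (hA : ContDiff ℝ 2 A) : ContDiff ℝ 2 (smoothLagrangian f φ A Q ρ) := by
  unfold smoothLagrangian
  have hR : ContDiff ℝ 2 fun p : E × Z × G => A p.1 + Q p.2.1 := by fun_prop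
  exact ((((hf.comp contDiff_fst).add (hφ.comp (contDiff_fst.comp contDiff_snd))).add
    (contDiff_snd.snd.inner ℝ hR)).add (contDiff_const.mul (hR.norm_sq ℝ)))

theorem fderiv_smoothLagrangian_apply (hf : ContDiff ℝ 2 f) (hφ : ContDiff ℝ 2 φ)
    (hA : ContDiff ℝ 2 A) (p : E × Z × G) (v : E) (u : Z) :
    fderiv ℝ (smoothLagrangian f φ A Q ρ) p (v, u, 0) =
      fderiv ℝ f p.1 v + fderiv ℝ φ p.2.1 u +
        ⟪p.2.2 + ρ • (A p.1 + Q p.2.1), fderiv ℝ A p.1 v + Q u⟫ := by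
  have hx : HasFDerivAt (fun p : E × Z × G => p.1) _ p := (hasFDerivAt_id (𝕜 := ℝ) p).fst
  have hz : HasFDerivAt (fun p : E × Z × G => p.2.1) _ p := (hasFDerivAt_id (𝕜 := ℝ) p).snd.fst
  have hw : HasFDerivAt (fun p : E × Z × G => p.2.2) _ p := (hasFDerivAt_id (𝕜 := ℝ) p).snd.snd
  have hf' := (hf.differentiable (by norm_num) p.1).hasFDerivAt.comp p hx
  have hφ' := (hφ.differentiable (by norm_num) p.2.1).hasFDerivAt.comp p hz
  have hR := ((hA.differentiable (by norm_num) p.1).hasFDerivAt.comp p hx).add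
    (Q.hasFDerivAt.comp p hz)
  have h := ((hf'.add hφ').add (hw.inner ℝ hR)).add (hR.norm_sq.const_mul (ρ / 2))
  have h' : HasFDerivAt (smoothLagrangian f φ A Q ρ) _ p := h
  rw [h'.fderiv]
  simp [inner_add_left, inner_add_right, real_inner_smul_left]
  ring

/-- Near a feasible point and a zero multiplier the augmented Lagrangian satisfies the first-order
inequality of a strongly convex function of `(x, z)`. -/
theorem eventually_smoothLagrangian_le (hf : ContDiff ℝ 2 f) (hφ : ContDiff ℝ 2 φ)
    (hA : ContDiff ℝ 2 A) {μf μφ : ℝ} (hμf : 0 < μf) (hfc : StrongConvexOn Set.univ μf f)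
    (hφc : StrongConvexOn Set.univ μφ φ) (hρ : 0 ≤ ρ) {xs : E} {zs : Z} (hs : A xs + Q zs = 0) :
    ∀ᶠ p in 𝓝 ((xs, zs, 0) : E × Z × G),
      smoothLagrangian f φ A Q ρ p +
        fderiv ℝ (smoothLagrangian f φ A Q ρ) p (xs - p.1, zs - p.2.1, 0) +
        μf / 4 * ‖xs - p.1‖ ^ 2 + μφ / 2 * ‖zs - p.2.1‖ ^ 2 ≤
      smoothLagrangian f φ A Q ρ (xs, zs, p.2.2) := by
  obtain ⟨K, hK0, hK⟩ := eventually_taylor_remainder_le hA xs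
  have h1 := (continuous_fst.tendsto ((xs, zs, 0) : E × Z × G)).eventually hK
  -- The effective multiplier vanishes at `(xs, zs, 0)` by feasibility and the zero multiplier, so
  -- near it the curvature of `A` costs at most half of the `μf / 2` supplied by `f`.
  have h2 : ∀ᶠ p in 𝓝 ((xs, zs, 0) : E × Z × G),
      ‖p.2.2 + ρ • (A p.1 + Q p.2.1)‖ * K < μf / 4 := by
    have hc : Continuous fun p : E × Z × G => ‖p.2.2 + ρ • (A p.1 + Q p.2.1)‖ * K := by
      have := hA.continuous
      fun_prop
    refine (hc.tendsto _).eventually_lt_const ?_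
    simpa [hs] using hμf
  filter_upwards [h1, h2] with p hp1 hp2
  have hf1 := add_fderiv_le_of_strongConvexOn hfc (hf.differentiable (by norm_num) p.1) xs
  have hφ1 := add_fderiv_le_of_strongConvexOn hφc (hφ.differentiable (by norm_num) p.2.1) zs
  rw [fderiv_smoothLagrangian_apply hf hφ hA]
  simp only [smoothLagrangian, hs, inner_zero_right, norm_zero]
  set R := A p.1 + Q p.2.1 with hR
  set D := fderiv ℝ A p.1 (xs - p.1) with hD
  -- By feasibility of the limit, the residual linearized at `p` and evaluated at `(xs, zs)` is
  -- minus the Taylor remainder of `A`.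
  have hrem : A xs - A p.1 - D = -(R + (D + Q (zs - p.2.1))) := by
    rw [map_sub, hR, eq_neg_of_add_eq_zero_left hs]; abel
  have h3 : ⟪p.2.2 + ρ • R, R + (D + Q (zs - p.2.1))⟫ ≤ μf / 4 * ‖xs - p.1‖ ^ 2 := by
    calc _ ≤ ‖p.2.2 + ρ • R‖ * ‖R + (D + Q (zs - p.2.1))‖ := real_inner_le_norm _ _
      _ = ‖p.2.2 + ρ • R‖ * ‖A xs - A p.1 - D‖ := by rw [hrem, norm_neg]
      _ ≤ ‖p.2.2 + ρ • R‖ * (K * ‖xs - p.1‖ ^ 2) := by gcongr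
      _ = ‖p.2.2 + ρ • R‖ * K * ‖xs - p.1‖ ^ 2 := by ring
      _ ≤ _ := by gcongr
  rw [inner_add_right, inner_add_left (x := p.2.2), real_inner_smul_left,
    real_inner_self_eq_norm_sq] at h3
  have h4 : 0 ≤ ρ * ‖R‖ ^ 2 := by positivity
  linarith

end SmoothLagrangian

/-! ### Algebra of block vectors -/

section Blocks

variable {n : ℕ} {d : Fin n → ℕ}

theorem setBlock_sub_setBlock (x : BlockVec d) (i : Fin n) (y y' : EuclideanSpace ℝ (Fin (d i))) :
    setBlock x i y - setBlock x i y' = PiLp.single 2 i (y - y') := by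
  ext j
  rcases eq_or_ne j i with rfl | h <;> simp [setBlock, *]

theorem sum_single_apply (x : BlockVec d) : ∑ i, PiLp.single 2 i (x i) = x := by
  apply PiLp.ext
  intro j
  simp [WithLp.ofLp_sum, Finset.sum_apply]

theorem smul_setBlock_add_smul_setBlock (x : BlockVec d) (i : Fin n)
    (y y' : EuclideanSpace ℝ (Fin (d i))) {a b : ℝ} (hab : a + b = 1) :
    a • setBlock x i y + b • setBlock x i y' = setBlock x i (a • y + b • y') := by
  apply PiLp.ext
  intro j
  rcases eq_or_ne j i with rfl | h
  · simp [setBlock]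
  · simp [setBlock, h, ← add_smul, hab]

theorem strongConvexOn_comp_setBlock {m : ℝ} {f : BlockVec d → ℝ}
    (hf : StrongConvexOn Set.univ m f) (x : BlockVec d) (i : Fin n)
    {s : Set (EuclideanSpace ℝ (Fin (d i)))} (hs : Convex ℝ s) :
    StrongConvexOn s m fun y => f (setBlock x i y) := by
  refine ⟨hs, fun y _ y' _ a b ha hb hab => ?_⟩
  have := hf.2 (Set.mem_univ (setBlock x i y)) (Set.mem_univ (setBlock x i y')) ha hb hab
  rwa [smul_setBlock_add_smul_setBlock _ _ _ _ hab, setBlock_sub_setBlock, PiLp.norm_single] at this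

theorem IsMultiAffineQuadratic.contDiff {nc : ℕ} {A : BlockVec d → EuclideanSpace ℝ (Fin nc)}
    (hA : IsMultiAffineQuadratic A) : ContDiff ℝ 2 A := by
  rw [contDiff_euclidean]
  intro l
  obtain ⟨C, b, e, h⟩ := hA.quadratic l
  have hc : ∀ p, ContDiff ℝ 2 fun x : BlockVec d => coords x p := by
    intro p
    unfold coords
    fun_prop
  simp only [h, dotProduct, Matrix.mulVec]
  fun_prop

end Blocks
-- Block minimization: descent and optimality
section BlockSteps

variable {n : ℕ} {d : Fin n → ℕ} {Z G : Type*} [NormedAddCommGroup Z] [NormedSpace ℝ Z]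
  [NormedAddCommGroup G] [InnerProductSpace ℝ G]
  {f : BlockVec d → ℝ} {φ : Z → ℝ} {A : BlockVec d → G} {Q : Z →L[ℝ] G} {ρ : ℝ}


theorem norm_sub_gaussSeidelPoint_le (u v : BlockVec d) (i : Fin n) :
    ‖u - gaussSeidelPoint u v i (u i)‖ ≤ ‖u - v‖ := by
  refine le_of_sq_le_sq ?_ (norm_nonneg _)
  rw [PiLp.norm_sq_eq_of_L2, PiLp.norm_sq_eq_of_L2]
  refine Finset.sum_le_sum fun j _ => ?_
  rcases eq_or_ne j i with rfl | h
  · simp [gaussSeidelPoint, setBlock]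
  · by_cases h' : j < i <;> simp [gaussSeidelPoint, setBlock, h, h']

/-- Decrease of the augmented Lagrangian in a block minimization. -/
theorem block_descent {μ : ℝ} (hf : StrongConvexOn Set.univ μ f) (hρ : 0 ≤ ρ)
    (b : BlockVec d) (i : Fin n) (z : Z) (w : G)
    (hA : ∃ g : EuclideanSpace ℝ (Fin (d i)) →ᵃ[ℝ] G, ∀ y, A (setBlock b i y) = g y)
    {s : Set (EuclideanSpace ℝ (Fin (d i)))} (hs : Convex ℝ s)
    {y y' : EuclideanSpace ℝ (Fin (d i))} (hy : y ∈ s) (hy' : y' ∈ s)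
    (hmin : ∀ y' ∈ s, smoothLagrangian f φ A Q ρ (setBlock b i y, z, w) ≤
      smoothLagrangian f φ A Q ρ (setBlock b i y', z, w)) :
    smoothLagrangian f φ A Q ρ (setBlock b i y, z, w) + μ / 2 * ‖y' - y‖ ^ 2 ≤
      smoothLagrangian f φ A Q ρ (setBlock b i y', z, w) := by
  obtain ⟨g, hg⟩ := hA
  refine quadratic_growth_of_isMinOn
    (g := fun y => smoothLagrangian f φ A Q ρ (setBlock b i y, z, w)) ?_ hy hy' hmin
  have h1 := (convexOn_inner_add_sq hρ w (g + AffineMap.const ℝ _ (Q z))).subset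
    (Set.subset_univ s) hs
  convert! strongConvexOn_add_convexOn (strongConvexOn_comp_setBlock hf b i hs)
    ((convexOn_const (φ z) hs).add h1) using 2 with y
  simp [smoothLagrangian, hg]
  ring

/-- Decrease of the augmented Lagrangian over a Gauss-Seidel sweep. -/
theorem sweep_descent {μ : ℝ} (hf : StrongConvexOn Set.univ μ f) (hρ : 0 ≤ ρ) (z : Z) (w : G)
    (hA : ∀ (i : Fin n) (x : BlockVec d),
      ∃ g : EuclideanSpace ℝ (Fin (d i)) →ᵃ[ℝ] G, ∀ y, A (setBlock x i y) = g y)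
    {X : ∀ i : Fin n, Set (EuclideanSpace ℝ (Fin (d i)))} (hX : ∀ i, Convex ℝ (X i))
    {u v : BlockVec d} (hu : ∀ i, u i ∈ X i) (hv : ∀ i, v i ∈ X i)
    (hmin : ∀ i, ∀ y ∈ X i,
      smoothLagrangian f φ A Q ρ (gaussSeidelPoint u v i (u i), z, w) ≤
        smoothLagrangian f φ A Q ρ (gaussSeidelPoint u v i y, z, w)) :
    smoothLagrangian f φ A Q ρ (u, z, w) + μ / 2 * ‖u - v‖ ^ 2 ≤
      smoothLagrangian f φ A Q ρ (v, z, w) := by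
  -- `P m` has its first `m` blocks updated, so the update of block `i` leads from `P i` to `P (i +
  -- 1)` and the decreases telescope from `v` to `u`.
  let P : ℕ → BlockVec d := fun m => WithLp.toLp 2 fun j => if j.val < m then u j else v j
  let a : ℕ → ℝ := fun m => smoothLagrangian f φ A Q ρ (P m, z, w)
  have hP0 : P 0 = v := by
    apply PiLp.ext; intro j; simp [P]
  have hPn : P n = u := by
    apply PiLp.ext; intro j; simp [P]
  have hstep : ∀ i : Fin n, μ / 2 * ‖u i - v i‖ ^ 2 ≤ a i - a (i + 1) := by
    intro i
    have h1 := block_descent (φ := φ) (Q := Q) hf hρ _ i z w (hA i _) (hX i) (hu i) (hv i) (hmin i)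
    have e1 : gaussSeidelPoint u v i (u i) = P (i + 1) := by
      apply PiLp.ext; intro j
      rcases eq_or_ne j i with rfl | h
      · simp [P, gaussSeidelPoint, setBlock]
      · have : (j.val < i.val + 1) ↔ j < i := by omega
        simp [P, gaussSeidelPoint, setBlock, h, this]
    have e2 : gaussSeidelPoint u v i (v i) = P i := by
      apply PiLp.ext; intro j
      rcases eq_or_ne j i with rfl | h
      · simp [P, gaussSeidelPoint, setBlock]
      · simp [P, gaussSeidelPoint, setBlock, h]
    change smoothLagrangian f φ A Q ρ (gaussSeidelPoint u v i (u i), z, w) + _ ≤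
      smoothLagrangian f φ A Q ρ (gaussSeidelPoint u v i (v i), z, w) at h1
    rw [e1, e2, norm_sub_rev] at h1
    simp only [a]
    linarith
  have hsum : ∑ i : Fin n, (a i - a (i + 1)) = a 0 - a n := by
    rw [← Finset.sum_range_sub' a n, Finset.sum_range]
  have h2 := Finset.sum_le_sum fun i (_ : i ∈ Finset.univ) => hstep i
  rw [hsum, ← Finset.mul_sum] at h2
  have h3 : ‖u - v‖ ^ 2 = ∑ i, ‖u i - v i‖ ^ 2 := by
    rw [PiLp.norm_sq_eq_of_L2]; rfl
  simp only [a, hP0, hPn, ← h3] at h2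
  linarith

theorem block_optimality (hH : Differentiable ℝ (smoothLagrangian f φ A Q ρ))
    (b : BlockVec d) (i : Fin n) (z : Z) (w : G)
    {s : Set (EuclideanSpace ℝ (Fin (d i)))} (hs : Convex ℝ s)
    {y y' : EuclideanSpace ℝ (Fin (d i))} (hy : y ∈ s) (hy' : y' ∈ s)
    (hmin : ∀ y' ∈ s, smoothLagrangian f φ A Q ρ (setBlock b i y, z, w) ≤
      smoothLagrangian f φ A Q ρ (setBlock b i y', z, w)) :
    0 ≤ fderiv ℝ (smoothLagrangian f φ A Q ρ) (setBlock b i y, z, w)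
      (PiLp.single 2 i (y' - y), 0, 0) := by
  have h := fderiv_sub_nonneg_of_min_segment (hH (setBlock b i y, z, w))
    (y := (setBlock b i y', z, w)) ?_
  · have e : (setBlock b i y', z, w) - (setBlock b i y, z, w) =
        ((PiLp.single 2 i (y' - y), 0, 0) : BlockVec d × Z × G) := by
      simp [setBlock_sub_setBlock, Prod.ext_iff]
    rwa [e] at h
  · rintro _ ⟨α, β, hα, hβ, hαβ, rfl⟩
    have h2 := hmin _ (hs hy hy' hα hβ hαβ)
    simpa [smul_setBlock_add_smul_setBlock _ _ _ _ hαβ, ← add_smul, hαβ] using h2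

end BlockSteps

/-! ### The `z`-step and the multiplier step -/

section DualSteps

variable {E Z G : Type*}
  [NormedAddCommGroup Z] [NormedSpace ℝ Z] [NormedAddCommGroup G] [InnerProductSpace ℝ G]
  {f : E → ℝ} {φ : Z → ℝ} {A : E → G} {Q : Z →L[ℝ] G} {ρ : ℝ}

theorem z_descent {μ : ℝ} (hφ : StrongConvexOn Set.univ μ φ) (hρ : 0 ≤ ρ) (x : E) (w : G)
    {z z' : Z} (hmin : ∀ y, smoothLagrangian f φ A Q ρ (x, z', w) ≤
      smoothLagrangian f φ A Q ρ (x, y, w)) :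
    smoothLagrangian f φ A Q ρ (x, z', w) + μ / 2 * ‖z' - z‖ ^ 2 ≤
      smoothLagrangian f φ A Q ρ (x, z, w) := by
  rw [norm_sub_rev]
  refine quadratic_growth_of_isMinOn (s := Set.univ)
    (g := fun y => smoothLagrangian f φ A Q ρ (x, y, w)) ?_ (Set.mem_univ _) (Set.mem_univ _)
    fun y _ => hmin y
  have h1 := convexOn_inner_add_sq hρ w
    (Q.toLinearMap.toAffineMap + AffineMap.const ℝ _ (A x))
  convert! strongConvexOn_add_convexOn hφ ((convexOn_const (f x) convex_univ).add h1) using 2 with y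
  simp [smoothLagrangian, add_comm (A x)]
  ring

theorem z_optimality [NormedAddCommGroup E] [NormedSpace ℝ E]
    (hH : Differentiable ℝ (smoothLagrangian f φ A Q ρ)) (x : E) (w : G)
    {z' : Z} (hmin : ∀ y, smoothLagrangian f φ A Q ρ (x, z', w) ≤
      smoothLagrangian f φ A Q ρ (x, y, w)) (v : Z) :
    fderiv ℝ (smoothLagrangian f φ A Q ρ) (x, z', w) (0, v, 0) = 0 := by
  have key : ∀ v, 0 ≤ fderiv ℝ (smoothLagrangian f φ A Q ρ) (x, z', w) (0, v, 0) := by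
    intro v
    have h := fderiv_sub_nonneg_of_min_segment (hH (x, z', w)) (y := (x, z' + v, w)) ?_
    · simpa using h
    · rintro _ ⟨α, β, hα, hβ, hαβ, rfl⟩
      have h2 := hmin (α • z' + β • (z' + v))
      simpa [← add_smul, hαβ] using h2
  refine le_antisymm ?_ (key v)
  have h := key (-v)
  have e : ((0, -v, 0) : E × Z × G) = -(0, v, 0) := by simp
  rw [e, map_neg] at h
  linarith

/-- The Lagrangian is affine in the multiplier with slope the residual, which is `ρ⁻¹ (w' - w)`. -/
theorem multiplier_step (x : E) (z : Z) (w : G) {w' : G}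
    (hw : w' = w + ρ • (A x + Q z)) (hρ : 0 < ρ) :
    smoothLagrangian f φ A Q ρ (x, z, w') =
      smoothLagrangian f φ A Q ρ (x, z, w) + ρ⁻¹ * ‖w' - w‖ ^ 2 := by
  have hρ' := hρ.ne'
  have h : w' - w = ρ • (A x + Q z) := by rw [hw]; abel
  rw [h]
  simp only [smoothLagrangian, hw]
  generalize A x + Q z = r
  simp only [norm_smul, inner_add_left, real_inner_smul_left,
    real_inner_self_eq_norm_sq, mul_pow, Real.norm_eq_abs, sq_abs]
  field_simp
  ring

end DualSteps

/-! ### Geometric decay from a contraction -/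

section Rate

theorem isBigO_zpow_neg_of_contraction {a : ℕ → ℝ} {C : ℝ} (hC : 0 < C) {N : ℕ}
    (h0 : ∀ k, N ≤ k → 0 ≤ a k) (h : ∀ k, N ≤ k → a (k + 1) ≤ C * (a k - a (k + 1))) :
    ∃ c : ℝ, 1 < c ∧ a =O[atTop] fun k : ℕ => c ^ (-(k : ℤ)) := by
  -- The hypothesis rearranges to `a (k + 1) ≤ C / (1 + C) * a k`.
  set c := (1 + C) / C with hc
  have hc1 : 1 < c := by rw [hc, lt_div_iff₀ hC]; linarith
  have hc0 : 0 < c := by linarith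
  refine ⟨c, hc1, IsBigO.of_bound (a N * c ^ N) ?_⟩
  have key : ∀ m, c ^ m * a (N + m) ≤ a N := by
    intro m
    induction m with
    | zero => simp
    | succ m ih =>
      have h1 := h (N + m) (by omega)
      have h2 : c * a (N + m + 1) ≤ a (N + m) := by
        rw [hc, div_mul_eq_mul_div, div_le_iff₀ hC]; linarith
      calc c ^ (m + 1) * a (N + (m + 1)) = c ^ m * (c * a (N + m + 1)) := by
            rw [pow_succ, mul_assoc]; rfl
        _ ≤ c ^ m * a (N + m) := by gcongr
        _ ≤ a N := ih
  filter_upwards [eventually_ge_atTop N] with k hk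
  obtain ⟨m, rfl⟩ := Nat.exists_eq_add_of_le hk
  rw [Real.norm_of_nonneg (h0 _ hk), zpow_neg, zpow_natCast,
    Real.norm_of_nonneg (by positivity), ← div_eq_mul_inv, le_div_iff₀ (by positivity)]
  calc a (N + m) * c ^ (N + m) = c ^ N * (c ^ m * a (N + m)) := by ring
    _ ≤ c ^ N * a N := by gcongr; exact key m
    _ = _ := by ring

end Rate
-- The gap is bounded by the squared step
section ErrorBound

variable {n : ℕ} {d : Fin n → ℕ} {Z G : Type*} [NormedAddCommGroup Z] [NormedSpace ℝ Z]
  [NormedAddCommGroup G] [InnerProductSpace ℝ G]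

/-- Each optimality condition holds at an intermediate point with an old multiplier. Moving it to
the new iterate changes the derivative by at most `K δ`, with `δ` the total step length; the
direction to the limit splits into `n` block directions and one `z` direction. -/
theorem neg_fderiv_le_of_approx_stationary {H : BlockVec d × Z × G → ℝ} {K : NNReal}
    {t : Set (BlockVec d × Z × G)} (hK : LipschitzOnWith K (fderiv ℝ H) t)
    {u v xs : BlockVec d} {z z' zs : Z} {w w' : G} (hu : (u, z', w') ∈ t)
    (hG : ∀ i, (gaussSeidelPoint u v i (u i), z, w) ∈ t) (hz : (u, z', w) ∈ t)
    (hxopt : ∀ i, 0 ≤ fderiv ℝ H (gaussSeidelPoint u v i (u i), z, w)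
      (PiLp.single 2 i (xs i - u i), 0, 0))
    (hzopt : fderiv ℝ H (u, z', w) (0, zs - z', 0) = 0) :
    -fderiv ℝ H (u, z', w') (xs - u, zs - z', 0) ≤
      K * (n + 1) * (‖u - v‖ + ‖z' - z‖ + ‖w' - w‖) * (‖xs - u‖ + ‖zs - z'‖) := by
  set δ := ‖u - v‖ + ‖z' - z‖ + ‖w' - w‖ with hδ
  have hδ1 : ‖u - v‖ ≤ δ := by linarith [norm_nonneg (z' - z), norm_nonneg (w' - w)]
  have hδ2 : ‖z' - z‖ ≤ δ := by linarith [norm_nonneg (u - v), norm_nonneg (w' - w)]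
  have hδ3 : ‖w' - w‖ ≤ δ := by linarith [norm_nonneg (u - v), norm_nonneg (z' - z)]
  have hδ0 : 0 ≤ δ := (norm_nonneg _).trans hδ1
  have hzb : -fderiv ℝ H (u, z', w') (0, zs - z', 0) ≤ K * δ * ‖zs - z'‖ := by
    calc _ = (fderiv ℝ H (u, z', w) - fderiv ℝ H (u, z', w')) (0, zs - z', 0) := by
          simp [hzopt]
      _ ≤ ‖fderiv ℝ H (u, z', w) - fderiv ℝ H (u, z', w')‖ *
            ‖((0, zs - z', 0) : BlockVec d × Z × G)‖ :=
          (Real.le_norm_self _).trans (ContinuousLinearMap.le_opNorm _ _)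
      _ ≤ (K * ‖((u, z', w) - (u, z', w') : BlockVec d × Z × G)‖) * ‖zs - z'‖ := by
          gcongr
          · exact hK.norm_sub_le hz hu
          · simp [Prod.norm_def]
      _ ≤ K * δ * ‖zs - z'‖ := by
          gcongr
          simpa [Prod.norm_def, norm_sub_rev w w'] using hδ3
  have hxb : ∀ i, -fderiv ℝ H (u, z', w') (PiLp.single 2 i (xs i - u i), 0, 0) ≤
      K * δ * ‖xs - u‖ := by
    intro i
    calc _ ≤ (fderiv ℝ H (gaussSeidelPoint u v i (u i), z, w) - fderiv ℝ H (u, z', w'))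
            (PiLp.single 2 i (xs i - u i), 0, 0) := by
          rw [sub_apply]; linarith [hxopt i]
      _ ≤ ‖fderiv ℝ H (gaussSeidelPoint u v i (u i), z, w) - fderiv ℝ H (u, z', w')‖ *
            ‖((PiLp.single 2 i (xs i - u i), 0, 0) : BlockVec d × Z × G)‖ :=
          (Real.le_norm_self _).trans (ContinuousLinearMap.le_opNorm _ _)
      _ ≤ (K * ‖((gaussSeidelPoint u v i (u i), z, w) - (u, z', w') : BlockVec d × Z × G)‖) *
            ‖xs - u‖ := by
          gcongr
          · exact hK.norm_sub_le (hG i) hu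
          · simpa [Prod.norm_def] using PiLp.norm_apply_le (xs - u) i
      _ ≤ K * δ * ‖xs - u‖ := by
          gcongr
          rw [norm_sub_rev]
          refine max_le ((norm_sub_gaussSeidelPoint_le u v i).trans hδ1) (max_le hδ2 hδ3)
  have hdec : ((xs - u, zs - z', 0) : BlockVec d × Z × G) =
      ∑ i, ((PiLp.single 2 i (xs i - u i), 0, 0) : BlockVec d × Z × G) + (0, zs - z', 0) := by
    have h1 : ∑ i, PiLp.single 2 i (xs i - u i) = xs - u := sum_single_apply (xs - u)
    simp [Prod.ext_iff, Prod.fst_sum, Prod.snd_sum, h1]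
  rw [hdec, map_add, map_sum, neg_add, ← Finset.sum_neg_distrib]
  have h2 := Finset.sum_le_sum fun i (_ : i ∈ Finset.univ) => hxb i
  simp only [Finset.sum_const, Finset.card_univ, Fintype.card_fin, nsmul_eq_mul] at h2
  have h3 : 0 ≤ K * δ * ‖xs - u‖ := by positivity
  have h4 : 0 ≤ n * (K * δ * ‖zs - z'‖) := by positivity
  linarith

/-- Completing the square. It removes the unknown distance to the limit, at the price of a squared
step. -/
theorem mul_sub_quadratic_le {K δ a μ : ℝ} (hμ : 0 < μ) :
    K * δ * a - μ / 4 * a ^ 2 ≤ K ^ 2 / μ * δ ^ 2 := by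
  have h : K ^ 2 / μ * δ ^ 2 - (K * δ * a - μ / 4 * a ^ 2) = (K * δ - μ / 2 * a) ^ 2 / μ := by
    field_simp
    ring
  have : 0 ≤ (K * δ - μ / 2 * a) ^ 2 / μ := by positivity
  linarith

theorem error_bound {f : BlockVec d → ℝ} {φ : Z → ℝ} {A : BlockVec d → G} {Q : Z →L[ℝ] G}
    {ρ μf μφ : ℝ} (hf : ContDiff ℝ 2 f) (hφ : ContDiff ℝ 2 φ) (hA : ContDiff ℝ 2 A)
    (hμf : 0 < μf) (hμφ : 0 < μφ) (hfc : StrongConvexOn Set.univ μf f)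
    (hφc : StrongConvexOn Set.univ μφ φ) (hρ : 0 ≤ ρ)
    {X : ∀ i : Fin n, Set (EuclideanSpace ℝ (Fin (d i)))} (hX : ∀ i, Convex ℝ (X i))
    {x : ℕ → BlockVec d} {z : ℕ → Z} {w : ℕ → G} {xs : BlockVec d} {zs : Z}
    (hxs : ∀ i, xs i ∈ X i) (hs : A xs + Q zs = 0)
    (hx : Tendsto x atTop (𝓝 xs)) (hz : Tendsto z atTop (𝓝 zs)) (hw : Tendsto w atTop (𝓝 0))
    (hmem : ∀ k i, x (k + 1) i ∈ X i)
    (hxmin : ∀ k, 1 ≤ k → ∀ i, ∀ y ∈ X i,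
      smoothLagrangian f φ A Q ρ (gaussSeidelPoint (x (k + 1)) (x k) i (x (k + 1) i), z k, w k) ≤
        smoothLagrangian f φ A Q ρ (gaussSeidelPoint (x (k + 1)) (x k) i y, z k, w k))
    (hzmin : ∀ k y, smoothLagrangian f φ A Q ρ (x (k + 1), z (k + 1), w k) ≤
      smoothLagrangian f φ A Q ρ (x (k + 1), y, w k)) :
    ∃ C : ℝ, 0 < C ∧ ∀ᶠ k in atTop,
      smoothLagrangian f φ A Q ρ (x (k + 1), z (k + 1), w (k + 1)) -
          smoothLagrangian f φ A Q ρ (xs, zs, w (k + 1)) ≤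
        C * (‖x (k + 1) - x k‖ ^ 2 + ‖z (k + 1) - z k‖ ^ 2 + ‖w (k + 1) - w k‖ ^ 2) := by
  have hH := contDiff_smoothLagrangian (Q := Q) (ρ := ρ) hf hφ hA
  have hHd := hH.differentiable (by norm_num)
  obtain ⟨K, t, ht, hK⟩ := (hH.fderiv_right (m := 1) (by norm_num)).contDiffAt.exists_lipschitzOnWith
    (x := ((xs, zs, 0) : BlockVec d × Z × G))
  have hx' := hx.comp (tendsto_add_atTop_nat 1)
  have hz' := hz.comp (tendsto_add_atTop_nat 1)
  have hw' := hw.comp (tendsto_add_atTop_nat 1)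
  have hp := hx'.prodMk_nhds (hz'.prodMk_nhds hw')
  have hGS : ∀ i, Tendsto (fun k => gaussSeidelPoint (x (k + 1)) (x k) i (x (k + 1) i)) atTop
      (𝓝 xs) := by
    intro i
    have h1 : Tendsto (fun k => x (k + 1) - gaussSeidelPoint (x (k + 1)) (x k) i (x (k + 1) i))
        atTop (𝓝 0) := by
      refine squeeze_zero_norm (fun k => norm_sub_gaussSeidelPoint_le _ _ i) ?_
      simpa using (hx'.sub hx).norm
    simpa using hx'.sub h1
  set K' : ℝ := K * (n + 1)
  -- The factor `3` comes from squaring a sum of three step lengths; the `1` only ensures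
  -- positivity.
  refine ⟨3 * (K' ^ 2 / μf + K' ^ 2 / μφ) + 1, by positivity, ?_⟩
  filter_upwards [eventually_ge_atTop 1, hp.eventually (eventually_smoothLagrangian_le hf hφ hA hμf
    hfc hφc hρ hs), hp.eventually ht, (hx'.prodMk_nhds (hz'.prodMk_nhds hw)).eventually ht,
    eventually_all.2 fun i => ((hGS i).prodMk_nhds (hz.prodMk_nhds hw)).eventually ht]
    with k hk h1 h2 h3 h4
  simp only [Function.comp_apply] at h1 h2 h3
  have h5 := neg_fderiv_le_of_approx_stationary (xs := xs) (zs := zs) hK h2 h4 h3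
    (fun i => block_optimality hHd _ i (z k) (w k) (hX i) (hmem k i) (hxs i) (hxmin k hk i))
    (z_optimality hHd (x (k + 1)) (w k) (hzmin k) _)
  set a := ‖xs - x (k + 1)‖
  set b := ‖zs - z (k + 1)‖
  set δ₁ := ‖x (k + 1) - x k‖
  set δ₂ := ‖z (k + 1) - z k‖
  set δ₃ := ‖w (k + 1) - w k‖
  have h6 := mul_sub_quadratic_le (K := K') (δ := δ₁ + δ₂ + δ₃) (a := a) hμf
  have h7 := mul_sub_quadratic_le (K := K') (δ := δ₁ + δ₂ + δ₃) (a := b) hμφ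
  have h8 : (δ₁ + δ₂ + δ₃) ^ 2 ≤ 3 * (δ₁ ^ 2 + δ₂ ^ 2 + δ₃ ^ 2) := by
    linarith [sq_nonneg (δ₁ - δ₂), sq_nonneg (δ₁ - δ₃), sq_nonneg (δ₂ - δ₃)]
  have h9 : (K' ^ 2 / μf + K' ^ 2 / μφ) * (δ₁ + δ₂ + δ₃) ^ 2 ≤
      (K' ^ 2 / μf + K' ^ 2 / μφ) * (3 * (δ₁ ^ 2 + δ₂ ^ 2 + δ₃ ^ 2)) := by gcongr
  have h10 : 0 ≤ μφ * b ^ 2 := by positivity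
  have h11 : 0 ≤ δ₁ ^ 2 + δ₂ ^ 2 + δ₃ ^ 2 := by positivity
  linarith

end ErrorBound

/-! ### From extended-valued ADMM to the smooth Lagrangian -/

section Reduction

variable {n nc nz : ℕ} {d : Fin n → ℕ} {f : BlockVec d → ℝ}
  {X : ∀ i : Fin n, Set (EuclideanSpace ℝ (Fin (d i)))} {φ : EuclideanSpace ℝ (Fin nz) → ℝ}
  {A : BlockVec d → EuclideanSpace ℝ (Fin nc)} {Q : Matrix (Fin nc) (Fin nz) ℝ} {ρ : ℝ}

theorem augLagrangian_of_mem {x : BlockVec d} (hx : ∀ i, x i ∈ X i)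
    (z : EuclideanSpace ℝ (Fin nz)) (w : EuclideanSpace ℝ (Fin nc)) :
    augLagrangian f X φ A Q ρ x z w = (smoothLagrangian f φ A (matCLM Q) ρ (x, z, w) : ℝ) := by
  have h : objective f X x = (f x : EReal) := by
    simp [objective, convexIndicator, hx]
  rw [augLagrangian, h, ← EReal.coe_add]
  congr 1
  simp only [smoothLagrangian, residual, matCLM_apply]
  ring

theorem mem_of_augLagrangian_ne_top {x : BlockVec d} {z : EuclideanSpace ℝ (Fin nz)}
    {w : EuclideanSpace ℝ (Fin nc)} (h : augLagrangian f X φ A Q ρ x z w ≠ ⊤) (i : Fin n) :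
    x i ∈ X i := by
  by_contra hi
  apply h
  have h0 : ∀ j, 0 ≤ convexIndicator (X j) (x j) := by
    intro j
    unfold convexIndicator
    split_ifs <;> simp
  have h1 : ∑ j, convexIndicator (X j) (x j) = ⊤ := by
    refine top_unique (le_trans (le_of_eq ?_)
      (Finset.single_le_sum (fun j _ => h0 j) (Finset.mem_univ i)))
    simp [convexIndicator, hi]
  rw [augLagrangian, objective, h1, EReal.coe_add_top, EReal.top_add_coe]

theorem gaussSeidelPoint_mem {u v : BlockVec d} (hu : ∀ i, u i ∈ X i) (hv : ∀ i, v i ∈ X i)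
    (i : Fin n) {y : EuclideanSpace ℝ (Fin (d i))} (hy : y ∈ X i) (j : Fin n) :
    gaussSeidelPoint u v i y j ∈ X j := by
  rcases eq_or_ne j i with rfl | h
  · simpa [gaussSeidelPoint, setBlock] using hy
  · by_cases h' : j < i <;> simp [gaussSeidelPoint, setBlock, h, h', hu, hv]

variable {x : ℕ → BlockVec d} {z : ℕ → EuclideanSpace ℝ (Fin nz)}
  {w : ℕ → EuclideanSpace ℝ (Fin nc)}

/-- A minimizer has a value other than `⊤`, which forces every indicator to vanish at the
Gauss-Seidel point. -/
theorem IsADMM.mem (h : IsADMM f X φ A Q ρ x z w) (k : ℕ) (i : Fin n) : x (k + 1) i ∈ X i := by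
  have := mem_of_augLagrangian_ne_top (h.x_step k i).1 i
  simpa [gaussSeidelPoint, setBlock] using this

theorem IsADMM.x_min (h : IsADMM f X φ A Q ρ x z w) {k : ℕ} (hk : 1 ≤ k) (i : Fin n)
    (y : EuclideanSpace ℝ (Fin (d i))) (hy : y ∈ X i) :
    smoothLagrangian f φ A (matCLM Q) ρ
        (gaussSeidelPoint (x (k + 1)) (x k) i (x (k + 1) i), z k, w k) ≤
      smoothLagrangian f φ A (matCLM Q) ρ (gaussSeidelPoint (x (k + 1)) (x k) i y, z k, w k) := by
  obtain ⟨k, rfl⟩ := Nat.exists_eq_add_of_le' hk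
  have h1 := (h.x_step (k + 1) i).2 y
  simp only at h1
  rwa [augLagrangian_of_mem (gaussSeidelPoint_mem (h.mem _) (h.mem _) i (h.mem _ i)),
    augLagrangian_of_mem (gaussSeidelPoint_mem (h.mem _) (h.mem _) i hy),
    EReal.coe_le_coe_iff] at h1

theorem IsADMM.z_min (h : IsADMM f X φ A Q ρ x z w) (k : ℕ) (y : EuclideanSpace ℝ (Fin nz)) :
    smoothLagrangian f φ A (matCLM Q) ρ (x (k + 1), z (k + 1), w k) ≤
      smoothLagrangian f φ A (matCLM Q) ρ (x (k + 1), y, w k) := by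
  have h1 := (h.z_step k).2 y
  simp only at h1
  rwa [augLagrangian_of_mem (h.mem k), augLagrangian_of_mem (h.mem k),
    EReal.coe_le_coe_iff] at h1

/-- The multiplier update turns the optimality of the `z`-step into `∇φ(z) + Qᵀ w = 0` at the new
iterate, so `z` controls `w`. -/
theorem IsADMM.fderiv_add_inner (h : IsADMM f X φ A Q ρ x z w) (hf : ContDiff ℝ 2 f)
    (hφ : ContDiff ℝ 2 φ) (hA : ContDiff ℝ 2 A) (k : ℕ) (v : EuclideanSpace ℝ (Fin nz)) :
    fderiv ℝ φ (z (k + 1)) v + ⟪w (k + 1), matCLM Q v⟫ = 0 := by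
  have h1 := z_optimality ((contDiff_smoothLagrangian hf hφ hA).differentiable (by norm_num))
    (x (k + 1)) (w k) (h.z_min k) v
  rw [fderiv_smoothLagrangian_apply hf hφ hA] at h1
  rw [h.w_step k]
  simpa [residual, matCLM_apply] using h1

/-- Differencing `Qᵀ w = -∇φ(z)` gives `‖Qᵀ Δw‖ ≤ L ‖Δz‖`, and the condition on `ρ` bounds `Qᵀ` from
below. The identity needs a preceding `z`-step, hence `1 ≤ k`. The constant makes the rise `ρ⁻¹
‖Δw‖²` at most half of the `z`-descent `μ / 2 ‖Δz‖²`. -/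
theorem IsADMM.norm_sq_multiplier_step_le (h : IsADMM f X φ A Q ρ x z w) (hf : ContDiff ℝ 2 f)
    (hφ : ContDiff ℝ 2 φ) (hA : ContDiff ℝ 2 A) {L μ : ℝ} (hL : IsLSmooth L φ) (hμ : 0 < μ)
    (hρ : 0 < ρ) (hQ : Q.rank = nc) (hρL : 4 * L ^ 2 / (μ * minPosEigenvalue (Qᵀ * Q)) ≤ ρ)
    {k : ℕ} (hk : 1 ≤ k) :
    ‖w (k + 1) - w k‖ ^ 2 ≤ ρ * (μ / 4) * ‖z (k + 1) - z k‖ ^ 2 := by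
  obtain ⟨k, rfl⟩ := Nat.exists_eq_add_of_le' hk
  set v := matCLM Qᵀ (w (k + 1 + 1) - w (k + 1)) with hv
  have h1 := h.fderiv_add_inner hf hφ hA (k + 1) v
  have h2 := h.fderiv_add_inner hf hφ hA k v
  have h3 : ‖v‖ * ‖v‖ ≤ L * ‖z (k + 1 + 1) - z (k + 1)‖ * ‖v‖ := by
    calc ‖v‖ * ‖v‖ = ⟪v, v⟫ := (real_inner_self_eq_norm_mul_norm v).symm
      _ = -⟪gradient φ (z (k + 1 + 1)) - gradient φ (z (k + 1)), v⟫ := by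
          conv_lhs => rw [hv, inner_matCLM_transpose, ← hv]
          rw [inner_sub_left, inner_sub_left, inner_gradient_left, inner_gradient_left]
          linarith
      _ ≤ ‖gradient φ (z (k + 1 + 1)) - gradient φ (z (k + 1))‖ * ‖v‖ :=
          (neg_le_abs _).trans (abs_real_inner_le_norm _ _)
      _ ≤ _ := by gcongr; exact hL.2 _ _
  have h4 : ‖v‖ ≤ L * ‖z (k + 1 + 1) - z (k + 1)‖ := by
    rcases (norm_nonneg v).eq_or_lt' with h0 | h0
    · rw [h0]; exact mul_nonneg hL.1.le (norm_nonneg _)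
    · exact le_of_mul_le_mul_right h3 h0
  have h5 := norm_sq_le_of_penalty_le hQ hμ hρL (w (k + 1 + 1) - w (k + 1))
  have h6 : ‖v‖ ^ 2 ≤ (L * ‖z (k + 1 + 1) - z (k + 1)‖) ^ 2 := by gcongr
  have h7 : ρ * μ * ‖v‖ ^ 2 ≤ ρ * μ * (L * ‖z (k + 1 + 1) - z (k + 1)‖) ^ 2 := by gcongr
  have hL2 : 0 < 4 * L ^ 2 := by have := hL.1; positivity
  refine le_of_mul_le_mul_left ?_ hL2
  calc _ ≤ _ := h5
    _ ≤ _ := h7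
    _ = _ := by ring

/-- One ADMM iteration decreases the augmented Lagrangian. -/
theorem IsADMM.descent (h : IsADMM f X φ A Q ρ x z w) (hf : ContDiff ℝ 2 f)
    (hφ : ContDiff ℝ 2 φ) (hA : IsMultiAffineQuadratic A) {L μf μφ : ℝ}
    (hfc : StrongConvexOn Set.univ μf f) (hφc : StrongConvexOn Set.univ μφ φ)
    (hX : ∀ i, Convex ℝ (X i)) (hL : IsLSmooth L φ) (hμ : 0 < μφ)
    (hρ : 0 < ρ) (hQ : Q.rank = nc) (hρL : 4 * L ^ 2 / (μφ * minPosEigenvalue (Qᵀ * Q)) ≤ ρ)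
    {k : ℕ} (hk : 1 ≤ k) :
    smoothLagrangian f φ A (matCLM Q) ρ (x (k + 1), z (k + 1), w (k + 1)) +
        μf / 2 * ‖x (k + 1) - x k‖ ^ 2 + μφ / 4 * ‖z (k + 1) - z k‖ ^ 2 ≤
      smoothLagrangian f φ A (matCLM Q) ρ (x k, z k, w k) := by
  have hxk : ∀ i, x k i ∈ X i := by
    obtain ⟨j, rfl⟩ := Nat.exists_eq_add_of_le' hk
    exact h.mem j
  have h1 := sweep_descent (φ := φ) (Q := matCLM Q) hfc hρ.le (z k) (w k)
    (fun i x => hA.affine i x) hX (h.mem k) hxk (h.x_min hk)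
  have h2 := z_descent (f := f) (A := A) (Q := matCLM Q) hφc hρ.le (x (k + 1)) (w k)
    (z := z k) (h.z_min k)
  have h3 := multiplier_step (f := f) (φ := φ) (A := A) (Q := matCLM Q) (x (k + 1)) (z (k + 1))
    (w k) (w' := w (k + 1)) (h.w_step k) hρ
  have h4 := h.norm_sq_multiplier_step_le hf hφ hA.contDiff hL hμ hρ hQ hρL hk
  have h5 : ρ⁻¹ * ‖w (k + 1) - w k‖ ^ 2 ≤ μφ / 4 * ‖z (k + 1) - z k‖ ^ 2 := by
    rw [inv_mul_le_iff₀ hρ]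
    linarith
  linarith

/-- The residual is `ρ⁻¹` times a multiplier step, and the steps of a convergent sequence vanish. -/
theorem IsADMM.residual_limit (h : IsADMM f X φ A Q ρ x z w) (hρ : ρ ≠ 0)
    (hA : Continuous A) {xs : BlockVec d} {zs : EuclideanSpace ℝ (Fin nz)}
    {ws : EuclideanSpace ℝ (Fin nc)} (hx : Tendsto x atTop (𝓝 xs)) (hz : Tendsto z atTop (𝓝 zs))
    (hw : Tendsto w atTop (𝓝 ws)) : A xs + matCLM Q zs = 0 := by
  have h1 : Tendsto (fun k => ρ • (A (x (k + 1)) + matCLM Q (z (k + 1)))) atTop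
      (𝓝 (ρ • (A xs + matCLM Q zs))) :=
    ((((hA.tendsto xs).comp hx).add (((matCLM Q).continuous.tendsto zs).comp hz)).const_smul
      ρ).comp (tendsto_add_atTop_nat 1)
  have h2 : Tendsto (fun k => ρ • (A (x (k + 1)) + matCLM Q (z (k + 1)))) atTop (𝓝 0) := by
    have h3 := (hw.comp (tendsto_add_atTop_nat 1)).sub hw
    rw [sub_self] at h3
    refine h3.congr fun k => ?_
    rw [Function.comp_apply, h.w_step k, add_sub_cancel_left]
    rfl
  exact (smul_eq_zero.1 (tendsto_nhds_unique h1 h2)).resolve_left hρ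

end Reduction
end ADMM

/-! ### Linear convergence of the augmented Lagrangian -/

theorem mainTheorem8 {n nc nz : ℕ} {d : Fin n → ℕ}
    (f : ADMM.BlockVec d → ℝ)
    (X : ∀ i : Fin n, Set (EuclideanSpace ℝ (Fin (d i))))
    (φ : EuclideanSpace ℝ (Fin nz) → ℝ)
    (A : ADMM.BlockVec d → EuclideanSpace ℝ (Fin nc))
    (Q : Matrix (Fin nc) (Fin nz) ℝ)
    (μf μφ Lφ ρ : ℝ)
    (hA : ADMM.IsMultiAffineQuadratic A)
    (hF : ADMM.IsSubanalyticFun (ADMM.objective f X))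
    (hf : ContDiff ℝ 2 f) (hμf : 0 < μf) (hfconv : StrongConvexOn Set.univ μf f)
    (hXconv : ∀ i, Convex ℝ (X i)) (hXclosed : ∀ i, IsClosed (X i))
    (hφ : ContDiff ℝ 2 φ) (hμφ : 0 < μφ) (hφconv : StrongConvexOn Set.univ μφ φ)
    (hφsmooth : ADMM.IsLSmooth Lφ φ)
    (hQ : Q.rank = nc)
    (hρ : 0 < ρ)
    (hρ' : max (4 * Lφ ^ 2 / (μφ * ADMM.minPosEigenvalue (Qᵀ * Q)))
      (4 * Lφ ^ 2 / (μφ * √(ADMM.minPosEigenvalue (Q * Qᵀ)))) ≤ ρ)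
    (x : ℕ → ADMM.BlockVec d) (z : ℕ → EuclideanSpace ℝ (Fin nz))
    (w : ℕ → EuclideanSpace ℝ (Fin nc))
    (hADMM : ADMM.IsADMM f X φ A Q ρ x z w)
    (xs : ADMM.BlockVec d) (zs : EuclideanSpace ℝ (Fin nz)) (ws : EuclideanSpace ℝ (Fin nc))
    (hx : Tendsto x atTop (𝓝 xs)) (hz : Tendsto z atTop (𝓝 zs)) (hw : Tendsto w atTop (𝓝 ws))
    (hws : ws = 0) :
    ∃ (ℓ : ℕ → ℝ) (ℓs : ℝ),
      (∀ k, 1 ≤ k → ADMM.augLagrangian f X φ A Q ρ (x k) (z k) (w k) = (ℓ k : EReal)) ∧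
      ADMM.augLagrangian f X φ A Q ρ xs zs ws = (ℓs : EReal) ∧
      ∃ c₁ : ℝ, 1 < c₁ ∧ (fun k => ℓ k - ℓs) =O[atTop] (fun k : ℕ => c₁ ^ (-(k : ℤ))) := by
  subst hws
  have hρL := (le_max_left _ _).trans hρ'
  have hAc := hA.contDiff
  have hxs : ∀ i, xs i ∈ X i := fun i =>
    (hXclosed i).mem_of_tendsto
      ((((PiLp.continuous_apply 2 _ i).tendsto xs).comp hx).comp (tendsto_add_atTop_nat 1))
      (Eventually.of_forall fun k => hADMM.mem k i)
  have hs := hADMM.residual_limit hρ.ne' hAc.continuous hx hz hw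
  set H := ADMM.smoothLagrangian f φ A (ADMM.matCLM Q) ρ with hH
  -- The error bound compares with the limit at the current multiplier; by feasibility that value
  -- does not depend on the multiplier.
  have hHconst : ∀ w', H (xs, zs, w') = H (xs, zs, 0) := fun w' => by
    simp [hH, ADMM.smoothLagrangian, hs]
  set a : ℕ → ℝ := fun k => H (x k, z k, w k) - H (xs, zs, 0) with ha
  have hdesc : ∀ k, 1 ≤ k →
      a (k + 1) + μf / 2 * ‖x (k + 1) - x k‖ ^ 2 + μφ / 4 * ‖z (k + 1) - z k‖ ^ 2 ≤ a k := by
    intro k hk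
    have := hADMM.descent hf hφ hA hfconv hφconv hXconv hφsmooth hμφ hρ hQ hρL hk
    simp only [ha, hH]
    linarith
  have hlim : Tendsto a atTop (𝓝 0) := by
    have h1 := ((ADMM.contDiff_smoothLagrangian (Q := ADMM.matCLM Q) (ρ := ρ) hf hφ
      hAc).continuous.tendsto (xs, zs, 0)).comp (hx.prodMk_nhds (hz.prodMk_nhds hw))
    have h2 := h1.sub_const (H (xs, zs, 0))
    rwa [← hH, sub_self] at h2
  -- The shift is needed because `x 0` may be infeasible and descent starts at index `1`.
  have hanti : Antitone fun k => a (k + 1) := antitone_nat_of_succ_le fun k => by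
    have := hdesc (k + 1) (by omega)
    have h1 : 0 ≤ μf / 2 * ‖x (k + 1 + 1) - x (k + 1)‖ ^ 2 := by positivity
    have h2 : 0 ≤ μφ / 4 * ‖z (k + 1 + 1) - z (k + 1)‖ ^ 2 := by positivity
    linarith
  have ha0 : ∀ k, 1 ≤ k → 0 ≤ a k := by
    intro k hk
    obtain ⟨k, rfl⟩ := Nat.exists_eq_add_of_le' hk
    exact hanti.le_of_tendsto (hlim.comp (tendsto_add_atTop_nat 1)) k
  obtain ⟨C, hC, hbound⟩ := ADMM.error_bound (Q := ADMM.matCLM Q) hf hφ hAc hμf hμφ hfconv hφconv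
    hρ.le hXconv hxs hs hx hz hw hADMM.mem (fun k hk => hADMM.x_min hk) hADMM.z_min
  obtain ⟨N, hN⟩ := eventually_atTop.1 hbound
  -- The factors `2 / μf` and `4 / μφ` convert descent into bounds on the squared `x` and `z` steps;
  -- `ρ * (μφ / 4)` accounts for the multiplier step.
  have hcontr : ∀ k, max N 1 ≤ k → a (k + 1) ≤
      C * (2 / μf + (1 + ρ * (μφ / 4)) * (4 / μφ)) * (a k - a (k + 1)) := by
    intro k hk
    have hk1 : 1 ≤ k := (le_max_right _ _).trans hk
    have h1 := hN k ((le_max_left _ _).trans hk)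
    rw [← hH, hHconst] at h1
    have h2 := hADMM.norm_sq_multiplier_step_le hf hφ hAc hφsmooth hμφ hρ hQ hρL hk1
    have h3 := hdesc k hk1
    set p := ‖x (k + 1) - x k‖ ^ 2
    set q := ‖z (k + 1) - z k‖ ^ 2
    have hp : 0 ≤ p := by positivity
    have hq : 0 ≤ q := by positivity
    have h4 : p ≤ 2 / μf * (a k - a (k + 1)) := by
      have h5 : 0 ≤ μφ / 4 * q := by positivity
      rw [div_mul_eq_mul_div, le_div_iff₀ hμf]
      linarith
    have h6 : q ≤ 4 / μφ * (a k - a (k + 1)) := by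
      have h5 : 0 ≤ μf / 2 * p := by positivity
      rw [div_mul_eq_mul_div, le_div_iff₀ hμφ]
      linarith
    calc a (k + 1) ≤ C * (p + q + ‖w (k + 1) - w k‖ ^ 2) := h1
      _ ≤ C * (p + q + ρ * (μφ / 4) * q) := by gcongr
      _ = C * (p + (1 + ρ * (μφ / 4)) * q) := by ring
      _ ≤ C * (2 / μf * (a k - a (k + 1)) +
            (1 + ρ * (μφ / 4)) * (4 / μφ * (a k - a (k + 1)))) := by gcongr
      _ = _ := by ring
  refine ⟨fun k => H (x k, z k, w k), H (xs, zs, 0), fun k hk => ?_,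
    ADMM.augLagrangian_of_mem hxs zs 0, ?_⟩
  · obtain ⟨k, rfl⟩ := Nat.exists_eq_add_of_le' hk
    exact ADMM.augLagrangian_of_mem (hADMM.mem k) _ _
  · exact ADMM.isBigO_zpow_neg_of_contraction (by positivity)
      (fun k hk => ha0 k ((le_max_right _ _).trans hk)) hcontr
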